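/- Consider the qutrit observables $A=\mathrm{diag}(1,-1,0)$ and $B=E_{13}+E_{31}$ on $\mathbb C^3$. A state is a positive semidefinite complex $3\times 3$ matrix $\rho$ with $\operatorname{tr}\rho=1$; for an observable $X$ put $\operatorname{Var}_\rho X=\operatorname{tr}[\rho X^2]-(\operatorname{tr}[\rho X])^2$ and $\Delta_\rho X=\sqrt{\operatorname{Var}_\rho X}$. Let $$R=\{(\operatorname{Var}_\rho A,\operatorname{Var}_\rho B) : \rho \text{ a state}\}\subset\mathbb R^2 .$$ Then the topological boundary of $R$ is the union of the following ten curve segments: 1. $y=1$, $x\in[0,\tfrac14]$; 2. $y=\tfrac18(9-4x)$, $x\in[\tfrac14,\tfrac34]$; 3. $y=\tfrac12(1+\sqrt{1-x})$, $x\in[\tfrac34,1]$; 4. $y=\tfrac12(1-\sqrt{1-x})$, $x\in[\tfrac{15}{16},1]$; 5. $y=2x^2-\tfrac{11}{4}x+\tfrac{153}{128}$, $x\in[\tfrac{13}{16},\tfrac{15}{16}]$; 6. $y=\tfrac18(4x-1)$, $x\in[\tfrac14,\tfrac{13}{16}]$; 7. $y=1-4x$, $x\in[\tfrac{15}{64},\tfrac14]$;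 8. $y=\tfrac12(1-\sqrt{1-x})$, $x\in[0,\tfrac{15}{64}]$; 9. $y=\tfrac12(1-\sqrt{1-4x})$, $x\in[0,\tfrac{3}{16}]$; 10. $y=1-4x$, $x\in[0,\tfrac{3}{16}]$. Moreover, $R$ is exactly the closed set enclosed by these segments: if $u:[0,1]\to\mathbb R$ is the function whose graph consists of segments 1, 2, 3 and $\ell:[0,1]\to\mathbb R$ the function whose graph consists of segments 8, 7, 6, 5, 4, then $(x,y)\in R$ if and only if $0\le x\le 1$, $\ell(x)\le y\le u(x)$, and, in case $x\le\tfrac{3}{16}$, either $y\le\tfrac12(1-\sqrt{1-4x})$ or $y\ge 1-4x$. The region $R$ is not convex and contains the origin $(0,0)$; the same two statements hold for the region $\{(\Delta_\rho A,\Delta_\rho B):\rho\text{ a state}\}$ of standard deviations. -/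

import Mathlib

open scoped ComplexOrder

namespace GellMannRegion

/-- A quantum state (density operator) on a finite-dimensional Hilbert space, as a matrix:
positive semidefinite (in particular Hermitian) with unit trace. -/
def IsState {n : Type*} [Fintype n] (ρ : Matrix n n ℂ) : Prop :=
  ρ.PosSemidef ∧ ρ.trace = 1

/-- The expectation value `tr[ρ X]` of an observable. It is a real number when `ρ` and `X` are
Hermitian; the real part is taken to obtain a term of type `ℝ`. -/
noncomputable def expect {n : Type*} [Fintype n] (ρ X : Matrix n n ℂ) : ℝ :=
  (ρ * X).trace.re

/-- The variance `tr[ρ X²] - (tr[ρ X])²`. -/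
noncomputable def variance {n : Type*} [Fintype n] (ρ X : Matrix n n ℂ) : ℝ :=
  expect ρ (X * X) - expect ρ X ^ 2

/-- The standard deviation. -/
noncomputable def stdDev {n : Type*} [Fintype n] (ρ X : Matrix n n ℂ) : ℝ :=
  Real.sqrt (variance ρ X)

/-- The uncertainty region in terms of variances. -/
def varRegion {n : Type*} [Fintype n] (X Y : Matrix n n ℂ) : Set (ℝ × ℝ) :=
  {z | ∃ ρ : Matrix n n ℂ, IsState ρ ∧ z = (variance ρ X, variance ρ Y)}

/-- The uncertainty region in terms of standard deviations. -/
def stdDevRegion {n : Type*} [Fintype n] (X Y : Matrix n n ℂ) : Set (ℝ × ℝ) :=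
  {z | ∃ ρ : Matrix n n ℂ, IsState ρ ∧ z = (stdDev ρ X, stdDev ρ Y)}

/-- The observable `diag(1, -1, 0)`. -/
def obsA : Matrix (Fin 3) (Fin 3) ℂ :=
  !![1, 0, 0; 0, -1, 0; 0, 0, 0]

/-- The observable `E₁₃ + E₃₁`. -/
def obsB : Matrix (Fin 3) (Fin 3) ℂ :=
  !![0, 0, 1; 0, 0, 0; 1, 0, 0]

/-- The segment over `[a, b]` of the curve `y = f x`. -/
def segmentOf (f : ℝ → ℝ) (a b : ℝ) : Set (ℝ × ℝ) :=
  {z | z.1 ∈ Set.Icc a b ∧ z.2 = f z.1}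

/-- The ten bounding curve segments, `x` being the variance of `A` and `y` that of `B`. -/
noncomputable def boundingCurve : Fin 10 → Set (ℝ × ℝ) :=
  ![segmentOf (fun _ => 1) 0 (1 / 4),
    segmentOf (fun x => (9 - 4 * x) / 8) (1 / 4) (3 / 4),
    segmentOf (fun x => (1 + Real.sqrt (1 - x)) / 2) (3 / 4) 1,
    segmentOf (fun x => (1 - Real.sqrt (1 - x)) / 2) (15 / 16) 1,
    segmentOf (fun x => 2 * x ^ 2 - 11 / 4 * x + 153 / 128) (13 / 16) (15 / 16),
    segmentOf (fun x => (4 * x - 1) / 8) (1 / 4) (13 / 16),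
    segmentOf (fun x => 1 - 4 * x) (15 / 64) (1 / 4),
    segmentOf (fun x => (1 - Real.sqrt (1 - x)) / 2) 0 (15 / 64),
    segmentOf (fun x => (1 - Real.sqrt (1 - 4 * x)) / 2) 0 (3 / 16),
    segmentOf (fun x => 1 - 4 * x) 0 (3 / 16)]

/-- The upper boundary (first to third segments). -/
noncomputable def upperBound (x : ℝ) : ℝ :=
  if x ≤ 1 / 4 then 1
  else if x ≤ 3 / 4 then (9 - 4 * x) / 8
  else (1 + Real.sqrt (1 - x)) / 2

/-- The lower boundary (eighth, seventh, sixth, fifth and fourth segments, from left to right). -/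
noncomputable def lowerBound (x : ℝ) : ℝ :=
  if x ≤ 15 / 64 then (1 - Real.sqrt (1 - x)) / 2
  else if x ≤ 1 / 4 then 1 - 4 * x
  else if x ≤ 13 / 16 then (4 * x - 1) / 8
  else if x ≤ 15 / 16 then 2 * x ^ 2 - 11 / 4 * x + 153 / 128
  else (1 - Real.sqrt (1 - x)) / 2

/-- The set enclosed by the ten segments: the points between the lower and the upper boundary,
without the open notch on the left that the ninth and tenth segments cut out. -/
noncomputable def enclosedRegion : Set (ℝ × ℝ) :=
  {z | 0 ≤ z.1 ∧ z.1 ≤ 1 ∧ lowerBound z.1 ≤ z.2 ∧ z.2 ≤ upperBound z.1 ∧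
    (z.1 ≤ 3 / 16 → z.2 ≤ (1 - Real.sqrt (1 - 4 * z.1)) / 2 ∨ 1 - 4 * z.1 ≤ z.2)}

end GellMannRegion

/-!
Write `x` for the variance of `A = obsA`, `d` for its expectation and `a`, `b`, `c` for the diagonal
of the state. Since `a - b = d` and `a + b = x + d²`, the pair `(x, d)` determines the populations
`a = (x + d² + d) / 2`, `b = (x + d² - d) / 2`, `c = 1 - x - d²`. The variance of `B = obsB` is
`1 - b - (2 Re ρ₁₃)²`, and positivity restricts `ρ₁₃` only by `|ρ₁₃|² ≤ a c`. The region is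
therefore the union, over all `(x, d)` with nonnegative populations, of the vertical segments
`1 - b - 4 a c ≤ y ≤ 1 - b` (`mem_varRegion_iff`).

For given `x` only an optimisation in `d` remains, and the quartic lower end is
explicit because it is a completed square,
`1 - b - 4 a c = 2 (d² + d / 2 + x - 3 / 4)² + (4 x - 1) / 8`.
For `x ≥ 1/4` the admissible `d` are those with `d² ≤ 1 - x`, so by the intermediate value theorem
the section over `x` is the interval between the least lower end and the greatest upper end
(`mem_varRegion_iff_of_ge`). The upper end is greatest at `d = 1/2`, or at `d = √(1 - x)` if that is
smaller. The square vanishes for some `d` up to `x = 13/16`; then it is least at its vertex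
`d = -1/4`, and from `x = 15/16` on at the boundary `d = -√(1 - x)`. For `x < 1/4` the admissible
`d` form three intervals, and the leftmost one produces the part of the section below the notch
(`mem_varRegion_iff_of_le`).

The boundary is found from the closed description: `enclosedRegion` is closed, removing the ten
segments leaves an open set, and from every point of a segment there is a direction in which all
small steps leave the region. Over `x = 0` the region consists of `(0, 0)` and `(0, 1)` only, which
excludes convexity, for variances and for standard deviations alike.
-/

open Filter Topology

namespace GellMannRegion

/-! ### The region as a union of vertical segments -/

/-- The greatest variance of `obsB` in a state with `Var A = x` and `⟨A⟩ = d`, attained when the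
coherence `ρ₁₃` has vanishing real part. -/
noncomputable def highVar (x d : ℝ) : ℝ := 1 - (x + d ^ 2 - d) / 2

/-- The least variance of `obsB` in a state with `Var A = x` and `⟨A⟩ = d`, attained when `ρ₁₃` is
as large as positivity permits. This is `1 - b - 4 * a * c`, with the square in `d` completed, for
the populations `a = (x + d² + d) / 2`, `b = (x + d² - d) / 2`, `c = 1 - x - d²`; see
`highVar_sub_lowVar`. -/
noncomputable def lowVar (x d : ℝ) : ℝ :=
  2 * (d ^ 2 + d / 2 + x - 3 / 4) ^ 2 + (4 * x - 1) / 8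

/-- `d` is the expectation of `obsA` in some state with `Var A = x`: the three populations are
nonnegative. -/
def Admissible (x d : ℝ) : Prop := d ^ 2 ≤ 1 - x ∧ d ≤ x + d ^ 2 ∧ -d ≤ x + d ^ 2

/-- The length of the vertical segment over `(x, d)` is `4 * a * c`. As `lowVar` is defined by its
completed square, this is where that completion is verified. -/
lemma highVar_sub_lowVar (x d : ℝ) :
    highVar x d - lowVar x d = 4 * ((x + d ^ 2 + d) / 2) * (1 - x - d ^ 2) := by
  unfold highVar lowVar; ring

lemma lowVar_le_highVar {x d : ℝ} (h : Admissible x d) : lowVar x d ≤ highVar x d := by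
  obtain ⟨h1, h2, h3⟩ := h
  have := highVar_sub_lowVar x d
  have : 0 ≤ 4 * ((x + d ^ 2 + d) / 2) * (1 - x - d ^ 2) :=
    mul_nonneg (by linarith) (by linarith)
  linarith

lemma variance_obsA {ρ : Matrix (Fin 3) (Fin 3) ℂ} :
    variance ρ obsA = (ρ 0 0).re + (ρ 1 1).re - ((ρ 0 0).re - (ρ 1 1).re) ^ 2 := by
  simp [variance, expect, obsA, Matrix.trace_fin_three, Matrix.mul_apply, Fin.sum_univ_three]
  ring

lemma variance_obsB {ρ : Matrix (Fin 3) (Fin 3) ℂ} :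
    variance ρ obsB = (ρ 0 0).re + (ρ 2 2).re - ((ρ 0 2).re + (ρ 2 0).re) ^ 2 := by
  simp [variance, expect, obsB, Matrix.trace_fin_three, Matrix.mul_apply, Fin.sum_univ_three]

lemma quadratic_form_nonneg {a c r : ℝ} (ha : 0 ≤ a) (hc : 0 ≤ c) (hr : r ^ 2 ≤ a * c) (p u : ℝ) :
    0 ≤ a * p ^ 2 + 2 * r * p * u + c * u ^ 2 := by
  rcases ha.eq_or_lt with rfl | ha
  · have : r = 0 := by nlinarith
    subst this
    nlinarith [mul_nonneg hc (sq_nonneg u)]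
  · have h : 0 ≤ a * (a * p ^ 2 + 2 * r * p * u + c * u ^ 2) := by
      nlinarith [sq_nonneg (a * p + r * u), mul_nonneg (sub_nonneg.2 hr) (sq_nonneg u)]
    exact nonneg_of_mul_nonneg_right h ha

/-- The states with real coherence `r` between the first and the third level and no other
coherences suffice for the whole region. -/
lemma isState_of_populations {a b c r : ℝ} (ha : 0 ≤ a) (hb : 0 ≤ b) (hc : 0 ≤ c)
    (hsum : a + b + c = 1) (hr : r ^ 2 ≤ a * c) :
    IsState (!![(a : ℂ), 0, r; 0, b, 0; r, 0, c] : Matrix (Fin 3) (Fin 3) ℂ) := by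
  constructor
  · refine Matrix.PosSemidef.of_dotProduct_mulVec_nonneg ?_ ?_
    · ext i j
      fin_cases i <;> fin_cases j <;> simp [Matrix.conjTranspose_apply]
    · intro v
      rw [Complex.le_def]
      constructor
      · simp [Matrix.mulVec, dotProduct, Fin.sum_univ_three]
        nlinarith [quadratic_form_nonneg ha hc hr (v 0).re (v 2).re,
          quadratic_form_nonneg ha hc hr (v 0).im (v 2).im,
          mul_nonneg hb (sq_nonneg (v 1).re), mul_nonneg hb (sq_nonneg (v 1).im)]
      · simp [Matrix.mulVec, dotProduct, Fin.sum_univ_three]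
        ring
  · simp only [Matrix.trace_fin_three]
    simp
    exact_mod_cast hsum

/-- The variance region is swept out by vertical segments, one for each admissible expectation of
`obsA`. -/
lemma mem_varRegion_iff (x y : ℝ) :
    (x, y) ∈ varRegion obsA obsB ↔ ∃ d, Admissible x d ∧ lowVar x d ≤ y ∧ y ≤ highVar x d := by
  constructor
  · rintro ⟨ρ, ⟨hρ, htr⟩, hz⟩
    obtain ⟨hx, hy⟩ := Prod.mk.inj hz
    rw [variance_obsA] at hx
    rw [variance_obsB] at hy
    -- The diagonal and the principal minor of the first and third level are nonnegative.
    have h0 := (Complex.le_def.1 (hρ.diag_nonneg (i := 0))).1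
    have h1 := (Complex.le_def.1 (hρ.diag_nonneg (i := 1))).1
    have h2 := (Complex.le_def.1 (hρ.diag_nonneg (i := 2))).1
    have i0 := (Complex.le_def.1 (hρ.diag_nonneg (i := 0))).2
    have hs : (ρ 2 0) = star (ρ 0 2) := (hρ.1.apply 2 0).symm
    have hre : (ρ 2 0).re = (ρ 0 2).re := by rw [hs]; simp
    have him : (ρ 2 0).im = -(ρ 0 2).im := by rw [hs]; simp
    have hdet := (Complex.le_def.1 (hρ.submatrix ![(0 : Fin 3), 2]).det_nonneg).1
    rw [Matrix.det_fin_two] at hdet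
    have htr' := congrArg Complex.re htr
    simp [Matrix.trace_fin_three, hre, him] at hdet htr' h0 h1 h2 i0
    rw [← i0] at hdet
    rw [hre] at hy
    have hc : (ρ 2 2).re = 1 - (ρ 0 0).re - (ρ 1 1).re := by linarith
    rw [hc] at hy hdet h2
    generalize (ρ 0 0).re = a at *
    generalize (ρ 1 1).re = b at *
    generalize (ρ 0 2).re = r at *
    have hs2 := sq_nonneg (ρ 0 2).im
    have hm : x + (a - b) ^ 2 = a + b := by linarith
    refine ⟨a - b, ⟨by linarith, by linarith, by linarith⟩, ?_, ?_⟩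
    · have := highVar_sub_lowVar x (a - b)
      rw [show 1 - x - (a - b) ^ 2 = 1 - a - b by linarith, hm] at this
      unfold highVar at this
      nlinarith
    · unfold highVar
      nlinarith [sq_nonneg r]
  · rintro ⟨d, ⟨h1, h2, h3⟩, hl, hh⟩
    have hd := highVar_sub_lowVar x d
    have hs : 0 ≤ highVar x d - y := by linarith
    refine ⟨_, isState_of_populations (a := (x + d ^ 2 + d) / 2) (b := (x + d ^ 2 - d) / 2)
      (c := 1 - x - d ^ 2) (r := √(highVar x d - y) / 2) (by linarith) (by linarith)
      (by linarith) (by ring) ?_, ?_⟩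
    · rw [div_pow, Real.sq_sqrt hs]
      linarith
    · rw [variance_obsA, variance_obsB]
      simp only [Matrix.of_apply, Matrix.cons_val, Complex.ofReal_re, add_halves, Real.sq_sqrt hs]
      ext
      · simp only; ring
      · simp only [highVar]; ring

/-! ### The sections of the region -/

/-- Moving `d` from a point whose segment starts below `y` to a point whose segment ends above `y`
passes a segment that contains `y`. -/
lemma exists_lowVar_le_le_highVar {x y d₀ d₁ : ℝ} (hadm : ∀ d ∈ Set.uIcc d₀ d₁, Admissible x d)
    (h₀ : lowVar x d₀ ≤ y) (h₁ : y ≤ highVar x d₁) :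
    ∃ d, Admissible x d ∧ lowVar x d ≤ y ∧ y ≤ highVar x d := by
  by_cases h : y ≤ highVar x d₀
  · exact ⟨d₀, hadm _ Set.left_mem_uIcc, h₀, h⟩
  · have hc : Continuous (highVar x) := by unfold highVar; fun_prop
    obtain ⟨d, hd, rfl⟩ := intermediate_value_uIcc (hc.continuousOn (s := Set.uIcc d₀ d₁))
      (Set.mem_uIcc_of_le (not_le.1 h).le h₁)
    exact ⟨d, hadm d hd, lowVar_le_highVar (hadm d hd), le_rfl⟩

/-- Over `0 ≤ x ≤ 1/4` the admissible expectations form three intervals; in the first `a` vanishes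
at the inner end, in the other two `b` vanishes at the ends `(1 ∓ w) / 2`, and `c` vanishes at the
ends `±t`. -/
lemma admissible_iff_of_le {x d w t : ℝ} (hx0 : 0 ≤ x) (hw0 : 0 ≤ w) (hw : w ^ 2 = 1 - 4 * x)
    (ht0 : 0 ≤ t) (ht : t ^ 2 = 1 - x) :
    Admissible x d ↔ (-t ≤ d ∧ d ≤ -((1 + w) / 2)) ∨ (-((1 - w) / 2) ≤ d ∧ d ≤ (1 - w) / 2) ∨
      ((1 + w) / 2 ≤ d ∧ d ≤ t) := by
  have hw1 : w ≤ 1 := by nlinarith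
  have hwt : (1 + w) / 2 ≤ t := by nlinarith
  constructor
  · rintro ⟨h1, h2, h3⟩
    obtain ⟨htl, htu⟩ := abs_le_of_sq_le_sq' (h1.trans ht.ge) ht0
    by_cases hl : d ≤ -((1 + w) / 2)
    · exact Or.inl ⟨htl, hl⟩
    by_cases hu : (1 + w) / 2 ≤ d
    · exact Or.inr (Or.inr ⟨hu, htu⟩)
    refine Or.inr (Or.inl ⟨?_, ?_⟩) <;> by_contra hc
    · nlinarith [mul_pos (show 0 < -d - (1 - w) / 2 by linarith)
        (show 0 < (1 + w) / 2 + d by linarith)]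
    · nlinarith [mul_pos (show 0 < d - (1 - w) / 2 by linarith)
        (show 0 < (1 + w) / 2 - d by linarith)]
  · rintro (⟨ha, hb⟩ | ⟨ha, hb⟩ | ⟨ha, hb⟩)
    · have h : d ^ 2 ≤ t ^ 2 := sq_le_sq' ha (by linarith)
      have := mul_nonneg (show 0 ≤ -d - (1 - w) / 2 by linarith)
        (show 0 ≤ -d - (1 + w) / 2 by linarith)
      exact ⟨by linarith, by linarith [sq_nonneg d], by linarith⟩
    · have h : d ^ 2 ≤ t ^ 2 := sq_le_sq' (by linarith) (by linarith)
      have h₁ := mul_nonneg (show 0 ≤ (1 - w) / 2 - d by linarith)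
        (show 0 ≤ (1 + w) / 2 - d by linarith)
      have h₂ := mul_nonneg (show 0 ≤ (1 - w) / 2 + d by linarith)
        (show 0 ≤ (1 + w) / 2 + d by linarith)
      exact ⟨by linarith, by linarith, by linarith⟩
    · have h : d ^ 2 ≤ t ^ 2 := sq_le_sq' (by linarith) hb
      have := mul_nonneg (show 0 ≤ d - (1 - w) / 2 by linarith)
        (show 0 ≤ d - (1 + w) / 2 by linarith)
      exact ⟨by linarith, by linarith, by linarith [sq_nonneg d]⟩

/-- The section of the variance region over `0 ≤ x ≤ 1/4` has two parts: the lower comes from the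
first interval of `admissible_iff_of_le`, the upper from the other two. -/
lemma mem_varRegion_iff_of_le {x y : ℝ} (hx0 : 0 ≤ x) (hx : x ≤ 1 / 4) :
    (x, y) ∈ varRegion obsA obsB ↔
      ((1 - √(1 - x)) / 2 ≤ y ∧ y ≤ (1 - √(1 - 4 * x)) / 2) ∨ (1 - 4 * x ≤ y ∧ y ≤ 1) := by
  rw [mem_varRegion_iff]
  have ht := Real.sq_sqrt (show 0 ≤ 1 - x by linarith)
  have hw := Real.sq_sqrt (show 0 ≤ 1 - 4 * x by linarith)
  have ht0 := Real.sqrt_nonneg (1 - x)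
  have hw0 := Real.sqrt_nonneg (1 - 4 * x)
  generalize √(1 - x) = t at *
  generalize √(1 - 4 * x) = w at *
  have hw1 : w ≤ 1 := by nlinarith
  have hwt : (1 + w) / 2 ≤ t := by nlinarith
  have ht1 : t ≤ 1 := by nlinarith
  have hadm := fun d => admissible_iff_of_le (d := d) hx0 hw0 hw ht0 ht
  constructor
  · rintro ⟨d, hd, hl, hh⟩
    have h2 := hd.2.1
    unfold lowVar at hl
    unfold highVar at hh
    rcases (hadm d).1 hd with ⟨ha, hb⟩ | ⟨ha, hb⟩ | ⟨ha, hb⟩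
    · left
      constructor
      · have := mul_nonneg (show 0 ≤ d + t by linarith) (show 0 ≤ t - 1 / 2 - d by linarith)
        have hq : -(1 / 4 - t / 2) ≤ -(d ^ 2 + d / 2 + x - 3 / 4) := by linarith
        have := pow_le_pow_left₀ (by linarith) hq 2
        linarith
      · have := mul_nonneg (show 0 ≤ -d - (1 + w) / 2 by linarith)
          (show 0 ≤ 1 - d + (1 + w) / 2 by linarith)
        linarith
    · right
      have := mul_nonneg (show 0 ≤ (1 - w) / 2 - d by linarith)
        (show 0 ≤ d + (1 - w) / 2 + 1 / 2 by linarith)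
      have hq : 3 * w / 4 ≤ -(d ^ 2 + d / 2 + x - 3 / 4) := by linarith
      have := pow_le_pow_left₀ (by linarith) hq 2
      exact ⟨by linarith, by linarith⟩
    · right
      have := mul_nonneg (show 0 ≤ d - (1 + w) / 2 by linarith)
        (show 0 ≤ d + (1 + w) / 2 + 1 / 2 by linarith)
      have hq : 3 * w / 4 ≤ d ^ 2 + d / 2 + x - 3 / 4 := by linarith
      have := pow_le_pow_left₀ (by linarith) hq 2
      exact ⟨by linarith, by linarith⟩
  · rintro (⟨h1, h2⟩ | ⟨h1, h2⟩)
    · refine exists_lowVar_le_le_highVar (d₀ := -t) (d₁ := -((1 + w) / 2)) ?_ ?_ ?_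
      · intro d hd
        rw [Set.uIcc_of_le (by linarith)] at hd
        exact (hadm d).2 (Or.inl hd)
      · rw [show lowVar x (-t) = (1 - t) / 2 by
          obtain rfl : x = 1 - t ^ 2 := by linarith
          unfold lowVar; ring]
        exact h1
      · rw [show highVar x (-((1 + w) / 2)) = (1 - w) / 2 by unfold highVar; linarith]
        exact h2
    -- The state with `b = 0` at the end of the middle interval covers the whole upper part.
    · refine ⟨(1 - w) / 2, (hadm _).2 (Or.inr (Or.inl ⟨by linarith, le_rfl⟩)), ?_, ?_⟩
      · rw [show lowVar x ((1 - w) / 2) = 1 - 4 * x by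
          obtain rfl : x = (1 - w ^ 2) / 4 := by linarith
          unfold lowVar; ring]
        exact h1
      · rw [show highVar x ((1 - w) / 2) = 1 by unfold highVar; linarith]
        exact h2

lemma admissible_iff_of_ge {x d : ℝ} (hx : 1 / 4 ≤ x) : Admissible x d ↔ d ^ 2 ≤ 1 - x :=
  ⟨fun h => h.1, fun h => ⟨h, by nlinarith [sq_nonneg (d - 1 / 2)],
    by nlinarith [sq_nonneg (d + 1 / 2)]⟩⟩

lemma highVar_le_upperBound {x d : ℝ} (hd : Admissible x d) :
    highVar x d ≤ upperBound x := by
  obtain ⟨h1, h2, h3⟩ := hd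
  unfold upperBound highVar
  split_ifs with ha hb
  · linarith
  · nlinarith [sq_nonneg (d - 1 / 2)]
  · have hdt := Real.abs_le_sqrt h1
    have ht := Real.sq_sqrt (show 0 ≤ 1 - x by nlinarith)
    have ht0 := Real.sqrt_nonneg (1 - x)
    generalize √(1 - x) = t at *
    have ht1 : t ≤ 1 / 2 := by nlinarith
    nlinarith [mul_nonneg (show 0 ≤ t - d by linarith [(abs_le.1 hdt).2])
      (show 0 ≤ 1 - t - d by linarith [(abs_le.1 hdt).2])]

/-- The square in `lowVar` can vanish up to `x = 13/16`; beyond, it is least at `d = -1/4` as long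
as this is admissible, and then at the end `d = -√(1 - x)` of the admissible range. -/
lemma lowerBound_le_lowVar {x d : ℝ} (hx : 1 / 4 ≤ x) (hd : Admissible x d) :
    lowerBound x ≤ lowVar x d := by
  obtain ⟨h1, h2, h3⟩ := hd
  unfold lowerBound lowVar
  split_ifs with ha hb hc hd'
  · linarith
  · nlinarith [sq_nonneg (d ^ 2 + d / 2 + x - 3 / 4)]
  · nlinarith [sq_nonneg (d ^ 2 + d / 2 + x - 3 / 4)]
  · have hq : x - 13 / 16 ≤ d ^ 2 + d / 2 + x - 3 / 4 := by nlinarith [sq_nonneg (d + 1 / 4)]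
    have := pow_le_pow_left₀ (by linarith) hq 2
    nlinarith
  · have hdt := Real.abs_le_sqrt h1
    have ht := Real.sq_sqrt (show 0 ≤ 1 - x by nlinarith)
    have ht0 := Real.sqrt_nonneg (1 - x)
    generalize √(1 - x) = t at *
    have ht1 : t ≤ 1 / 4 := by nlinarith
    have hq : 1 / 4 - t / 2 ≤ d ^ 2 + d / 2 + x - 3 / 4 := by
      nlinarith [mul_nonneg (show 0 ≤ d + t by linarith [(abs_le.1 hdt).1])
        (show 0 ≤ d - t + 1 / 2 by linarith [(abs_le.1 hdt).1])]
    have := pow_le_pow_left₀ (by linarith) hq 2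
    nlinarith

lemma exists_highVar_eq_upperBound {x : ℝ} (hx : 1 / 4 ≤ x) (hx1 : x ≤ 1) :
    ∃ d, d ^ 2 ≤ 1 - x ∧ highVar x d = upperBound x := by
  unfold upperBound highVar
  split_ifs with ha hb
  · exact ⟨1 / 2, by linarith, by linarith⟩
  · exact ⟨1 / 2, by linarith, by linarith⟩
  · have ht := Real.sq_sqrt (show 0 ≤ 1 - x by linarith)
    exact ⟨√(1 - x), ht.le, by rw [ht]; ring⟩

lemma exists_lowVar_eq_lowerBound {x : ℝ} (hx : 1 / 4 ≤ x) (hx1 : x ≤ 1) :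
    ∃ d, d ^ 2 ≤ 1 - x ∧ lowVar x d = lowerBound x := by
  unfold lowerBound lowVar
  split_ifs with ha hb hc hd
  · linarith
  · exact ⟨1 / 2, by linarith, by nlinarith⟩
  -- The larger root of `d ^ 2 + d / 2 + x - 3 / 4`.
  · have hs := Real.sq_sqrt (show 0 ≤ 13 / 16 - x by linarith)
    have hs0 := Real.sqrt_nonneg (13 / 16 - x)
    refine ⟨-1 / 4 + √(13 / 16 - x), by nlinarith, ?_⟩
    have : (-1 / 4 + √(13 / 16 - x)) ^ 2 + (-1 / 4 + √(13 / 16 - x)) / 2 + x - 3 / 4 = 0 := by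
      linear_combination hs
    rw [this]; ring
  · exact ⟨-1 / 4, by linarith, by ring⟩
  · have ht := Real.sq_sqrt (show 0 ≤ 1 - x by linarith)
    refine ⟨-√(1 - x), by rw [neg_sq]; exact ht.le, ?_⟩
    rw [neg_sq, ht]
    linear_combination (1 / 2) * ht

lemma mem_varRegion_iff_of_ge {x y : ℝ} (hx : 1 / 4 ≤ x) (hx1 : x ≤ 1) :
    (x, y) ∈ varRegion obsA obsB ↔ lowerBound x ≤ y ∧ y ≤ upperBound x := by
  rw [mem_varRegion_iff]
  constructor
  · rintro ⟨d, hd, hl, hh⟩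
    exact ⟨(lowerBound_le_lowVar hx hd).trans hl, hh.trans (highVar_le_upperBound hd)⟩
  · rintro ⟨hl, hh⟩
    obtain ⟨d₀, hd₀, h₀⟩ := exists_lowVar_eq_lowerBound hx hx1
    obtain ⟨d₁, hd₁, h₁⟩ := exists_highVar_eq_upperBound hx hx1
    refine exists_lowVar_le_le_highVar (d₀ := d₀) (d₁ := d₁) ?_ (h₀.le.trans hl) (hh.trans h₁.ge)
    intro d hd
    rw [admissible_iff_of_ge hx]
    have hmem : ∀ {e : ℝ}, e ^ 2 ≤ 1 - x → e ∈ Set.Icc (-√(1 - x)) √(1 - x) := fun he =>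
      abs_le.1 (Real.abs_le_sqrt he)
    have h := abs_le.2 (Set.uIcc_subset_Icc (hmem hd₀) (hmem hd₁) hd)
    exact (Real.le_sqrt (abs_nonneg d) (by linarith)).1 h |>.trans' (sq_abs d).ge

/-- The seventh and the eighth segment meet at `x = 15/64`. -/
lemma sqrt_one_sub_le_iff {x : ℝ} (hx1 : x ≤ 1 / 4) :
    (1 - √(1 - x)) / 2 ≤ 1 - 4 * x ↔ x ≤ 15 / 64 := by
  have ht := Real.sq_sqrt (show 0 ≤ 1 - x by linarith)
  have ht0 := Real.sqrt_nonneg (1 - x)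
  generalize √(1 - x) = t at *
  constructor <;> intro h
  · by_contra hc
    nlinarith
  · have : 7 / 8 ≤ t := by nlinarith
    nlinarith

/-- The notch between the ninth and the tenth segment closes at `x = 3/16`. -/
lemma one_sub_four_mul_le_iff {x : ℝ} (hx1 : x ≤ 1 / 4) :
    1 - 4 * x ≤ (1 - √(1 - 4 * x)) / 2 ↔ 3 / 16 ≤ x := by
  have ht := Real.sq_sqrt (show 0 ≤ 1 - 4 * x by linarith)
  have ht0 := Real.sqrt_nonneg (1 - 4 * x)
  generalize √(1 - 4 * x) = t at *
  constructor <;> intro h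
  · have : t ≤ 1 / 2 := by nlinarith
    nlinarith
  · have : t ≤ 1 / 2 := by nlinarith
    nlinarith

lemma le_one_sub_four_mul {x : ℝ} (hx : x ≤ 3 / 16) : (1 - √(1 - 4 * x)) / 2 ≤ 1 - 4 * x := by
  have hw := Real.sq_sqrt (show 0 ≤ 1 - 4 * x by linarith)
  have : 1 / 2 ≤ √(1 - 4 * x) := Real.le_sqrt_of_sq_le (by linarith)
  nlinarith

/-- Of the two parts of the section over `x ≤ 1/4`, the lower one `[(1 - t) / 2, (1 - w) / 2]` is
separated from the upper one `[1 - 4 * x, 1]` for `x < 3/16`, overlaps it for `3/16 ≤ x ≤ 15/64`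
and is contained in it for `15/64 ≤ x`. -/
theorem varRegion_eq_enclosedRegion : varRegion obsA obsB = enclosedRegion := by
  ext ⟨x, y⟩
  by_cases hx01 : 0 ≤ x ∧ x ≤ 1
  swap
  · refine iff_of_false ?_ fun h => hx01 ⟨h.1, h.2.1⟩
    rw [mem_varRegion_iff]
    rintro ⟨d, ⟨h1, h2, h3⟩, -⟩
    refine hx01 ⟨?_, by nlinarith⟩
    have : (x + d ^ 2) ≤ 1 := by linarith
    rcases abs_cases d with ⟨h, -⟩ | ⟨h, -⟩ <;> nlinarith [sq_abs d, abs_nonneg d]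
  obtain ⟨hx0, hx1⟩ := hx01
  rcases le_total x (1 / 4) with hx | hx
  · rw [mem_varRegion_iff_of_le hx0 hx]
    have e1 := sqrt_one_sub_le_iff hx
    have e2 := one_sub_four_mul_le_iff hx
    have hw0 := Real.sqrt_nonneg (1 - 4 * x)
    have hnotch : (1 - √(1 - 4 * x)) / 2 ≤ 1 := by linarith
    simp only [enclosedRegion, Set.mem_ofPred_eq, upperBound, lowerBound, hx, if_true, hx0, hx1,
      true_and]
    have e3 : x ≤ 3 / 16 → x ≤ 15 / 64 := fun h => by linarith
    by_cases h1 : x ≤ 3 / 16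
    · have := e1.2 (e3 h1)
      simp only [h1, e3 h1, if_true, true_imp_iff]
      constructor
      · rintro (⟨ha, hb⟩ | ⟨ha, hb⟩)
        · exact ⟨ha, hb.trans hnotch, Or.inl hb⟩
        · exact ⟨this.trans ha, hb, Or.inr ha⟩
      · rintro ⟨ha, hb, hc | hc⟩
        exacts [Or.inl ⟨ha, hc⟩, Or.inr ⟨hc, hb⟩]
    · have h1' := e2.2 (not_le.1 h1).le
      by_cases h2 : x ≤ 15 / 64
      · have := e1.2 h2
        simp only [h1, h2, if_true, false_imp_iff, and_true]
        constructor
        · rintro (⟨ha, hb⟩ | ⟨ha, hb⟩)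
          · exact ⟨ha, hb.trans hnotch⟩
          · exact ⟨this.trans ha, hb⟩
        · rintro ⟨ha, hb⟩
          rcases le_total y (1 - 4 * x) with hy | hy
          exacts [Or.inl ⟨ha, hy.trans h1'⟩, Or.inr ⟨hy, hb⟩]
      · have := (not_le.1 (mt e1.1 h2)).le
        simp only [h1, h2, if_false, false_imp_iff, and_true]
        constructor
        · rintro (⟨ha, hb⟩ | ⟨ha, hb⟩)
          · exact ⟨this.trans ha, hb.trans hnotch⟩
          · exact ⟨ha, hb⟩
        · exact Or.inr
  · rw [mem_varRegion_iff_of_ge hx hx1]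
    have : ¬ x ≤ 3 / 16 := by linarith
    simp [enclosedRegion, hx0, hx1, this]

/-! ### The boundary -/


lemma continuous_upperBound : Continuous upperBound := by
  have h₁ : Continuous fun x : ℝ =>
      if x ≤ 3 / 4 then (9 - 4 * x) / 8 else (1 + √(1 - x)) / 2 := by
    refine Continuous.if_le (by fun_prop) (by fun_prop) continuous_id continuous_const ?_
    rintro x rfl
    rw [show √(1 - (3 / 4 : ℝ)) = 1 / 2 by rw [Real.sqrt_eq_iff_mul_self_eq] <;> norm_num]
    norm_num
  refine Continuous.if_le continuous_const h₁ continuous_id continuous_const ?_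
  rintro x rfl
  norm_num

lemma continuous_lowerBound : Continuous lowerBound := by
  have h₁ : Continuous fun x : ℝ =>
      if x ≤ 15 / 16 then 2 * x ^ 2 - 11 / 4 * x + 153 / 128 else (1 - √(1 - x)) / 2 := by
    refine Continuous.if_le (by fun_prop) (by fun_prop) continuous_id continuous_const ?_
    rintro x rfl
    rw [show √(1 - (15 / 16 : ℝ)) = 1 / 4 by rw [Real.sqrt_eq_iff_mul_self_eq] <;> norm_num]
    norm_num
  have h₂ : Continuous fun x : ℝ => if x ≤ 13 / 16 then (4 * x - 1) / 8 else
      if x ≤ 15 / 16 then 2 * x ^ 2 - 11 / 4 * x + 153 / 128 else (1 - √(1 - x)) / 2 := by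
    refine Continuous.if_le (by fun_prop) h₁ continuous_id continuous_const ?_
    rintro x rfl
    norm_num
  have h₃ : Continuous fun x : ℝ => if x ≤ 1 / 4 then 1 - 4 * x else
      if x ≤ 13 / 16 then (4 * x - 1) / 8 else
      if x ≤ 15 / 16 then 2 * x ^ 2 - 11 / 4 * x + 153 / 128 else (1 - √(1 - x)) / 2 := by
    refine Continuous.if_le (by fun_prop) h₂ continuous_id continuous_const ?_
    rintro x rfl
    norm_num
  refine Continuous.if_le (by fun_prop) h₃ continuous_id continuous_const ?_
  rintro x rfl
  rw [show √(1 - (15 / 64 : ℝ)) = 7 / 8 by rw [Real.sqrt_eq_iff_mul_self_eq] <;> norm_num]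
  norm_num

lemma lowerBound_le_upperBound {x : ℝ} (hx0 : 0 ≤ x) (hx1 : x ≤ 1) :
    lowerBound x ≤ upperBound x := by
  have ht0 := Real.sqrt_nonneg (1 - x)
  unfold lowerBound upperBound
  split_ifs <;> nlinarith

lemma lowerBound_zero : lowerBound 0 = 0 := by norm_num [lowerBound]

lemma lowerBound_one : lowerBound 1 = 1 / 2 := by norm_num [lowerBound]

lemma upperBound_zero : upperBound 0 = 1 := by norm_num [upperBound]

lemma upperBound_one : upperBound 1 = 1 / 2 := by norm_num [upperBound]

/-- The first three segments form the graph of `upperBound`. -/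
lemma mem_upper_segments_iff (x y : ℝ) :
    ((x, y) ∈ boundingCurve 0 ∨ (x, y) ∈ boundingCurve 1 ∨ (x, y) ∈ boundingCurve 2) ↔
      0 ≤ x ∧ x ≤ 1 ∧ y = upperBound x := by
  have e : √(1 - (3 / 4 : ℝ)) = 1 / 2 := by rw [Real.sqrt_eq_iff_mul_self_eq] <;> norm_num
  simp only [boundingCurve, segmentOf, Matrix.cons_val, Set.mem_ofPred_eq, Set.mem_Icc]
  constructor
  · rintro (⟨⟨h1, h2⟩, rfl⟩ | ⟨⟨h1, h2⟩, rfl⟩ | ⟨⟨h1, h2⟩, rfl⟩)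
    · exact ⟨by linarith, by linarith, (if_pos h2).symm⟩
    · refine ⟨by linarith, by linarith, ?_⟩
      rcases h1.eq_or_lt with rfl | h
      · norm_num [upperBound]
      · simp only [upperBound, if_neg (not_le.2 h), if_pos h2]
    · refine ⟨by linarith, by linarith, ?_⟩
      rcases h1.eq_or_lt with rfl | h
      · rw [e]; norm_num [upperBound]
      · simp only [upperBound, if_neg (not_le.2 h),
          if_neg (not_le.2 (lt_trans (by norm_num : (1 / 4 : ℝ) < 3 / 4) h))]
  · rintro ⟨h0, h1, rfl⟩
    unfold upperBound
    split_ifs with ha hb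
    · exact Or.inl ⟨⟨h0, ha⟩, rfl⟩
    · exact Or.inr (Or.inl ⟨⟨by linarith, hb⟩, rfl⟩)
    · exact Or.inr (Or.inr ⟨⟨by linarith, h1⟩, rfl⟩)

/-- The fourth to eighth segments form the graph of `lowerBound`. -/
lemma mem_lower_segments_iff (x y : ℝ) :
    ((x, y) ∈ boundingCurve 3 ∨ (x, y) ∈ boundingCurve 4 ∨ (x, y) ∈ boundingCurve 5 ∨
      (x, y) ∈ boundingCurve 6 ∨ (x, y) ∈ boundingCurve 7) ↔
      0 ≤ x ∧ x ≤ 1 ∧ y = lowerBound x := by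
  have e : √(1 - (15 / 16 : ℝ)) = 1 / 4 := by rw [Real.sqrt_eq_iff_mul_self_eq] <;> norm_num
  have e' : √(1 - (15 / 64 : ℝ)) = 7 / 8 := by rw [Real.sqrt_eq_iff_mul_self_eq] <;> norm_num
  simp only [boundingCurve, segmentOf, Matrix.cons_val, Set.mem_ofPred_eq, Set.mem_Icc]
  constructor
  · rintro (⟨⟨h1, h2⟩, rfl⟩ | ⟨⟨h1, h2⟩, rfl⟩ | ⟨⟨h1, h2⟩, rfl⟩ | ⟨⟨h1, h2⟩, rfl⟩ | ⟨⟨h1, h2⟩, rfl⟩)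
    all_goals refine ⟨by linarith, by linarith, ?_⟩
    · rcases h1.eq_or_lt with rfl | h
      · rw [e]; norm_num [lowerBound]
      · unfold lowerBound
        split_ifs <;> first | rfl | linarith
    · rcases h1.eq_or_lt with rfl | h
      · norm_num [lowerBound]
      · unfold lowerBound
        split_ifs <;> first | rfl | linarith
    · rcases h1.eq_or_lt with rfl | h
      · norm_num [lowerBound]
      · unfold lowerBound
        split_ifs <;> first | rfl | linarith
    · rcases h1.eq_or_lt with rfl | h
      · norm_num [lowerBound, e']
      · unfold lowerBound
        split_ifs <;> first | rfl | linarith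
    · exact (if_pos h2).symm
  · rintro ⟨h0, h1, rfl⟩
    unfold lowerBound
    split_ifs with ha hb hc hd
    · exact Or.inr (Or.inr (Or.inr (Or.inr ⟨⟨h0, ha⟩, rfl⟩)))
    · exact Or.inr (Or.inr (Or.inr (Or.inl ⟨⟨by linarith, hb⟩, rfl⟩)))
    · exact Or.inr (Or.inr (Or.inl ⟨⟨by linarith, hc⟩, rfl⟩))
    · exact Or.inr (Or.inl ⟨⟨by linarith, hd⟩, rfl⟩)
    · exact Or.inl ⟨⟨by linarith, h1⟩, rfl⟩

lemma mem_iUnion_boundingCurve_iff (x y : ℝ) :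
    (x, y) ∈ (⋃ i : Fin 10, boundingCurve i) ↔
      (0 ≤ x ∧ x ≤ 1 ∧ (y = upperBound x ∨ y = lowerBound x)) ∨
      (0 ≤ x ∧ x ≤ 3 / 16 ∧ (y = (1 - √(1 - 4 * x)) / 2 ∨ y = 1 - 4 * x)) := by
  have hu := mem_upper_segments_iff x y
  have hl := mem_lower_segments_iff x y
  have h8 : (x, y) ∈ boundingCurve 8 ↔ (0 ≤ x ∧ x ≤ 3 / 16) ∧ y = (1 - √(1 - 4 * x)) / 2 := Iff.rfl
  have h9 : (x, y) ∈ boundingCurve 9 ↔ (0 ≤ x ∧ x ≤ 3 / 16) ∧ y = 1 - 4 * x := Iff.rfl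
  have h : (x, y) ∈ (⋃ i : Fin 10, boundingCurve i) ↔
      ((x, y) ∈ boundingCurve 0 ∨ (x, y) ∈ boundingCurve 1 ∨ (x, y) ∈ boundingCurve 2) ∨
      ((x, y) ∈ boundingCurve 3 ∨ (x, y) ∈ boundingCurve 4 ∨ (x, y) ∈ boundingCurve 5 ∨
        (x, y) ∈ boundingCurve 6 ∨ (x, y) ∈ boundingCurve 7) ∨
      (x, y) ∈ boundingCurve 8 ∨ (x, y) ∈ boundingCurve 9 := by
    simp only [Set.mem_iUnion, Fin.exists_fin_succ, IsEmpty.exists_iff, or_false, or_assoc]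
    rfl
  rw [h, hu, hl, h8, h9]
  constructor
  · rintro (⟨h0, h1, h⟩ | ⟨h0, h1, h⟩ | ⟨⟨h0, h1⟩, h⟩ | ⟨⟨h0, h1⟩, h⟩)
    exacts [Or.inl ⟨h0, h1, Or.inl h⟩, Or.inl ⟨h0, h1, Or.inr h⟩, Or.inr ⟨h0, h1, Or.inl h⟩,
      Or.inr ⟨h0, h1, Or.inr h⟩]
  · rintro (⟨h0, h1, h | h⟩ | ⟨h0, h1, h | h⟩)
    exacts [Or.inl ⟨h0, h1, h⟩, Or.inr (Or.inl ⟨h0, h1, h⟩),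
      Or.inr (Or.inr (Or.inl ⟨⟨h0, h1⟩, h⟩)), Or.inr (Or.inr (Or.inr ⟨⟨h0, h1⟩, h⟩))]

lemma isClosed_enclosedRegion : IsClosed enclosedRegion := by
  have e : enclosedRegion = {z : ℝ × ℝ | 0 ≤ z.1} ∩ {z | z.1 ≤ 1} ∩ {z | lowerBound z.1 ≤ z.2} ∩
      {z | z.2 ≤ upperBound z.1} ∩ ({z | 3 / 16 ≤ z.1} ∪
        ({z | z.2 ≤ (1 - √(1 - 4 * z.1)) / 2} ∪ {z | 1 - 4 * z.1 ≤ z.2})) := by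
    ext ⟨x, y⟩
    simp only [enclosedRegion, Set.mem_ofPred_eq, Set.mem_inter_iff, Set.mem_union]
    -- At `x = 3/16` the last condition holds for every `y`.
    have h : x = 3 / 16 → (y ≤ (1 - √(1 - 4 * x)) / 2 ∨ 1 - 4 * x ≤ y) := by
      rintro rfl
      have := (one_sub_four_mul_le_iff (x := 3 / 16) (by norm_num)).2 le_rfl
      rcases le_total y (1 - 4 * (3 / 16)) with hy | hy
      exacts [Or.inl (hy.trans this), Or.inr hy]
    rcases lt_trichotomy x (3 / 16) with hx | hx | hx
    · simp [hx.le, not_le.2 hx, and_assoc]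
    · have := h hx
      simp only [hx.ge, this, and_assoc, true_or, imp_true_iff, and_true]
    · simp [hx.le, not_le.2 hx, and_assoc]
  rw [e]
  have hu := continuous_upperBound.comp (continuous_fst (X := ℝ) (Y := ℝ))
  have hl := continuous_lowerBound.comp (continuous_fst (X := ℝ) (Y := ℝ))
  refine (((((isClosed_le ?_ ?_).inter (isClosed_le ?_ ?_)).inter
    (isClosed_le hl continuous_snd)).inter (isClosed_le continuous_snd hu)).inter
    ((isClosed_le ?_ ?_).union ((isClosed_le ?_ ?_).union (isClosed_le ?_ ?_)))) <;> fun_prop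

/-- The points of `enclosedRegion` off the ten segments form an open set. -/
lemma isOpen_enclosedRegion_diff :
    IsOpen (enclosedRegion \ ⋃ i : Fin 10, boundingCurve i) := by
  have e : enclosedRegion \ (⋃ i : Fin 10, boundingCurve i) =
      {z : ℝ × ℝ | 0 < z.1} ∩ {z | z.1 < 1} ∩ {z | lowerBound z.1 < z.2} ∩
      {z | z.2 < upperBound z.1} ∩ ({z | 3 / 16 < z.1} ∪
        ({z | z.2 < (1 - √(1 - 4 * z.1)) / 2} ∪ {z | 1 - 4 * z.1 < z.2})) := by
    ext ⟨x, y⟩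
    rw [Set.mem_sdiff, mem_iUnion_boundingCurve_iff]
    simp only [enclosedRegion, Set.mem_ofPred_eq, Set.mem_inter_iff, Set.mem_union]
    constructor
    · rintro ⟨⟨h0, h1, hl, hu, hn⟩, hc⟩
      have hcl : y ≠ lowerBound x := fun h => hc (Or.inl ⟨h0, h1, Or.inr h⟩)
      have hcu : y ≠ upperBound x := fun h => hc (Or.inl ⟨h0, h1, Or.inl h⟩)
      refine ⟨⟨⟨⟨h0.lt_of_ne ?_, h1.lt_of_ne ?_⟩, hl.lt_of_ne' hcl⟩, hu.lt_of_ne hcu⟩, ?_⟩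
      · rintro rfl
        rw [lowerBound_zero] at hcl hl
        rw [upperBound_zero] at hcu hu
        rcases hn (by norm_num) with h | h <;> norm_num at h
        exacts [hcl (le_antisymm h hl), hcu (le_antisymm hu h)]
      · rintro rfl
        rw [lowerBound_one] at hcl hl
        rw [upperBound_one] at hu
        exact hcl (le_antisymm hu hl)
      · rcases lt_or_ge (3 / 16) x with hx | hx
        · exact Or.inl hx
        · refine Or.inr ((hn hx).imp (fun h => h.lt_of_ne ?_) (fun h => h.lt_of_ne' ?_))
          exacts [fun h => hc (Or.inr ⟨h0, hx, Or.inl h⟩), fun h => hc (Or.inr ⟨h0, hx, Or.inr h⟩)]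
    · rintro ⟨⟨⟨⟨h0, h1⟩, hl⟩, hu⟩, hn⟩
      refine ⟨⟨h0.le, h1.le, hl.le, hu.le, fun hx => ?_⟩, ?_⟩
      · exact (hn.resolve_left hx.not_gt).imp le_of_lt le_of_lt
      · rintro (⟨-, -, h | h⟩ | ⟨-, hx, h⟩)
        · exact hu.ne h
        · exact hl.ne' h
        · have hlt := le_one_sub_four_mul hx
          rcases hn.resolve_left hx.not_gt with hn | hn <;> rcases h with h | h <;> linarith
  rw [e]
  have hu := continuous_upperBound.comp (continuous_fst (X := ℝ) (Y := ℝ))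
  have hl := continuous_lowerBound.comp (continuous_fst (X := ℝ) (Y := ℝ))
  refine (((((isOpen_lt ?_ ?_).inter (isOpen_lt ?_ ?_)).inter
    (isOpen_lt hl continuous_snd)).inter (isOpen_lt continuous_snd hu)).inter
    ((isOpen_lt ?_ ?_).union ((isOpen_lt ?_ ?_).union (isOpen_lt ?_ ?_)))) <;> fun_prop

/-- Points that leave `enclosedRegion` along every small step in a fixed direction `v` are not
interior. -/
lemma notMem_interior_of_forall_notMem {z v : ℝ × ℝ}
    (h : ∀ ε : ℝ, 0 < ε → z + ε • v ∉ enclosedRegion) : z ∉ interior enclosedRegion := by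
  intro hz
  have hc : Tendsto (fun ε : ℝ => z + ε • v) (𝓝[>] 0) (𝓝 z) := by
    have : Continuous fun ε : ℝ => z + ε • v := by fun_prop
    simpa using (this.tendsto 0).mono_left nhdsWithin_le_nhds
  obtain ⟨ε, hε, hpos⟩ :=
    ((hc.eventually (mem_interior_iff_mem_nhds.1 hz)).and self_mem_nhdsWithin).exists
  exact h ε hpos hε

lemma boundingCurve_subset_enclosedRegion : (⋃ i : Fin 10, boundingCurve i) ⊆ enclosedRegion := by
  rintro ⟨x, y⟩ hz
  rw [mem_iUnion_boundingCurve_iff] at hz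
  rcases hz with ⟨h0, h1, hy⟩ | ⟨h0, h1, hy⟩
  · have hlu := lowerBound_le_upperBound h0 h1
    rcases hy with rfl | rfl
    · refine ⟨h0, h1, hlu, le_rfl, fun hx => Or.inr ?_⟩
      change x ≤ 3 / 16 at hx
      change 1 - 4 * x ≤ upperBound x
      rw [upperBound, if_pos (by linarith)]
      linarith
    · refine ⟨h0, h1, le_rfl, hlu, fun hx => Or.inl ?_⟩
      change x ≤ 3 / 16 at hx
      change lowerBound x ≤ (1 - √(1 - 4 * x)) / 2
      rw [lowerBound, if_pos (by linarith)]
      have := Real.sqrt_le_sqrt (show 1 - 4 * x ≤ 1 - x by linarith)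
      linarith
  · have hl : lowerBound x = (1 - √(1 - x)) / 2 := if_pos (by linarith)
    have hu : upperBound x = 1 := if_pos (by linarith)
    have hw0 := Real.sqrt_nonneg (1 - 4 * x)
    have := Real.sqrt_le_sqrt (show 1 - 4 * x ≤ 1 - x by linarith)
    have := (sqrt_one_sub_le_iff (x := x) (by linarith)).2 (by linarith)
    rcases hy with rfl | rfl
    · exact ⟨h0, by change x ≤ 1; linarith, by change lowerBound x ≤ _; rw [hl]; linarith,
        by change _ ≤ upperBound x; rw [hu]; linarith, fun _ => Or.inl le_rfl⟩
    · exact ⟨h0, by change x ≤ 1; linarith, by change lowerBound x ≤ _; rwa [hl],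
        by change _ ≤ upperBound x; rw [hu]; linarith, fun _ => Or.inr le_rfl⟩

/-- The graph of `upperBound` is left upwards, that of `lowerBound` downwards, and the two sides of
the notch are left horizontally towards smaller `x`. -/
lemma notMem_interior_of_mem_boundingCurve {z : ℝ × ℝ} (hz : z ∈ ⋃ i : Fin 10, boundingCurve i) :
    z ∉ interior enclosedRegion := by
  obtain ⟨x, y⟩ := z
  rw [mem_iUnion_boundingCurve_iff] at hz
  rcases hz with ⟨h0, h1, rfl | rfl⟩ | ⟨h0, h1, hy⟩
  · refine notMem_interior_of_forall_notMem (v := (0, 1)) fun ε hε h => ?_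
    have := h.2.2.2.1
    simp at this
    linarith
  · refine notMem_interior_of_forall_notMem (v := (0, -1)) fun ε hε h => ?_
    have := h.2.2.1
    simp at this
    linarith
  · refine notMem_interior_of_forall_notMem (v := (-1, 0)) fun ε hε h => ?_
    have hn := h.2.2.2.2
    simp only [Prod.smul_mk, smul_eq_mul, mul_neg, mul_one, mul_zero, Prod.mk_add_mk,
      add_zero] at hn
    have hlt := le_one_sub_four_mul h1
    have hmono : √(1 - 4 * x) < √(1 - 4 * (x + -ε)) :=
      Real.sqrt_lt_sqrt (by linarith) (by linarith)
    rcases hn (by linarith) with hn | hn <;> rcases hy with rfl | rfl <;> linarith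

theorem frontier_enclosedRegion : frontier enclosedRegion = ⋃ i : Fin 10, boundingCurve i := by
  rw [isClosed_enclosedRegion.frontier_eq]
  ext z
  constructor
  · rintro ⟨hz, hi⟩
    by_contra hc
    exact hi (interior_maximal Set.sdiff_subset isOpen_enclosedRegion_diff ⟨hz, hc⟩)
  · exact fun hz => ⟨boundingCurve_subset_enclosedRegion hz,
      notMem_interior_of_mem_boundingCurve hz⟩

/-! ### Nonconvexity -/

/-- Over `x = 0` the region consists of the two points `y = 0` and `y = 1`. -/
lemma zero_mem_enclosedRegion_iff (y : ℝ) : (0, y) ∈ enclosedRegion ↔ y = 0 ∨ y = 1 := by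
  constructor
  · rintro ⟨-, -, hl, hu, hn⟩
    have hn' := hn (by norm_num)
    simp [lowerBound_zero, upperBound_zero] at hl hu hn'
    exact hn'.imp (fun h => le_antisymm h hl) (fun h => le_antisymm hu h)
  · rintro (rfl | rfl) <;> norm_num [enclosedRegion, lowerBound_zero, upperBound_zero]

theorem not_convex_enclosedRegion : ¬ Convex ℝ enclosedRegion := by
  intro h
  have := h ((zero_mem_enclosedRegion_iff 0).2 (Or.inl rfl))
    ((zero_mem_enclosedRegion_iff 1).2 (Or.inr rfl))
    (a := 1 / 2) (b := 1 / 2) (by norm_num) (by norm_num) (by norm_num)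
  simp only [Prod.smul_mk, smul_eq_mul, Prod.mk_add_mk, mul_zero, add_zero, mul_one, zero_add,
    zero_mem_enclosedRegion_iff] at this
  norm_num at this

lemma variance_obsA_nonneg {ρ : Matrix (Fin 3) (Fin 3) ℂ} (hρ : IsState ρ) :
    0 ≤ variance ρ obsA := by
  have h : (variance ρ obsA, variance ρ obsB) ∈ enclosedRegion :=
    varRegion_eq_enclosedRegion ▸ ⟨ρ, hρ, rfl⟩
  exact h.1

/-- The two points of the variance region over `x = 0` are fixed by the square root. -/
lemma zero_mem_stdDevRegion_iff {s : ℝ} (hs : 0 ≤ s) :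
    (0, s) ∈ stdDevRegion obsA obsB ↔ s = 0 ∨ s = 1 := by
  constructor
  · rintro ⟨ρ, hρ, hz⟩
    obtain ⟨hx, hy⟩ := Prod.mk.inj hz
    have hA : variance ρ obsA = 0 :=
      le_antisymm (Real.sqrt_eq_zero'.1 hx.symm) (variance_obsA_nonneg hρ)
    have h : (variance ρ obsA, variance ρ obsB) ∈ enclosedRegion :=
      varRegion_eq_enclosedRegion ▸ ⟨ρ, hρ, rfl⟩
    rw [hA, zero_mem_enclosedRegion_iff] at h
    rw [hy, stdDev]
    rcases h with h | h <;> simp [h]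
  · intro h
    have hm : (0, s) ∈ varRegion obsA obsB := by
      rwa [varRegion_eq_enclosedRegion, zero_mem_enclosedRegion_iff]
    obtain ⟨ρ, hρ, hz⟩ := hm
    obtain ⟨hx, hy⟩ := Prod.mk.inj hz
    refine ⟨ρ, hρ, ?_⟩
    rw [stdDev, stdDev, ← hx, ← hy]
    rcases h with rfl | rfl <;> simp

theorem not_convex_stdDevRegion : ¬ Convex ℝ (stdDevRegion obsA obsB) := by
  intro h
  have := h ((zero_mem_stdDevRegion_iff le_rfl).2 (Or.inl rfl))
    ((zero_mem_stdDevRegion_iff zero_le_one).2 (Or.inr rfl))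
    (a := 1 / 2) (b := 1 / 2) (by norm_num) (by norm_num) (by norm_num)
  simp only [Prod.smul_mk, smul_eq_mul, Prod.mk_add_mk, mul_zero, add_zero, mul_one,
    zero_add] at this
  rw [zero_mem_stdDevRegion_iff (by norm_num)] at this
  norm_num at this

end GellMannRegion

theorem mainTheorem6 :
    GellMannRegion.varRegion GellMannRegion.obsA GellMannRegion.obsB =
        GellMannRegion.enclosedRegion ∧
      frontier (GellMannRegion.varRegion GellMannRegion.obsA GellMannRegion.obsB) =
        (⋃ i : Fin 10, GellMannRegion.boundingCurve i) ∧
      ¬ Convex ℝ (GellMannRegion.varRegion GellMannRegion.obsA GellMannRegion.obsB) ∧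
      ((0, 0) : ℝ × ℝ) ∈ GellMannRegion.varRegion GellMannRegion.obsA GellMannRegion.obsB ∧
      ¬ Convex ℝ (GellMannRegion.stdDevRegion GellMannRegion.obsA GellMannRegion.obsB) ∧
      ((0, 0) : ℝ × ℝ) ∈ GellMannRegion.stdDevRegion GellMannRegion.obsA GellMannRegion.obsB := by
  open GellMannRegion in
  exact ⟨varRegion_eq_enclosedRegion,
    varRegion_eq_enclosedRegion ▸ frontier_enclosedRegion,
    varRegion_eq_enclosedRegion ▸ not_convex_enclosedRegion,
    varRegion_eq_enclosedRegion ▸ (zero_mem_enclosedRegion_iff 0).2 (Or.inl rfl),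
    not_convex_stdDevRegion, (zero_mem_stdDevRegion_iff le_rfl).2 (Or.inl rfl)⟩
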